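/- For $n\ge 5$ let $\mathcal D_n=(Q_n,\Sigma,\delta,1,\{n\})$ be the DFA with state set $Q_n=\{1,\dots,n\}$, alphabet $\Sigma=\{a,b,c,d,e,f\}$, initial state $1$, only final state $n$, and transitions given by the following transformations of $Q_n$ (all states not mentioned are fixed): $a$ is the cycle $(2,3,\dots,n-1)$; $b$ is the transposition $(2,3)$; $c$ maps $n-1$ to $2$; $d$ maps $n-1$ to $1$; $e$ maps every state of $\{1,\dots,n-1\}$ to $2$; $f$ maps $2$ to $n$. Let $L_n(a,b,-,d,e,f)$ be the language over the five-letter alphabet $\{a,b,d,e,f\}$ that consists of the words over this alphabet accepted by $\mathcal D_n$ (that is, the language of the DFA obtained from $\mathcal D_n$ by deleting the letter $c$). The complexity of a language $L$ over an alphabet $\Gamma$ is the number of distinct left quotients $w^{-1}L=\{x\in\Gamma^*\mid wx\in L\}$, $w\in\Gamma^*$; for regular $L$ it equals the number of states of a minimal complete DFA of $L$ over $\Gamma$. **Theorem (Two-Sided Ideals: Boolean Operations, $m\ne n$).** Suppose $m,n\ge 5$ and $m\neq n$. Then, over the alphabet $\{a,b,d,e,f\}$: 1. the complexity of $L_m(a,b,-,d,e,f)\cap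 L_n(a,b,-,d,e,f)$ is $mn$; 2. the complexity of $L_m(a,b,-,d,e,f)\oplus L_n(a,b,-,d,e,f)$ (symmetric difference) is $mn$; 3. the complexity of $L_m(a,b,-,d,e,f)\setminus L_n(a,b,-,d,e,f)$ is $mn-(m-1)$; 4. the complexity of $L_m(a,b,-,d,e,f)\cup L_n(a,b,-,d,e,f)$ is $mn-(m+n-2)$. -/

import Mathlib

namespace IdealStream

/-- Quotient complexity of a language over the alphabet `α`: the number of its distinct
left quotients `w⁻¹L`, `w` ranging over all words over `α`. -/
noncomputable def complexity {α : Type*} (L : Language α) : ℕ∞ :=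
  (Set.range L.leftQuotient).encard

/-- The image `π(α)` of a partial permutation `π` of `α`; it is the alphabet of the dialect. -/
abbrev DialectAlphabet {α : Type*} (π : α ≃. α) : Type _ :=
  {y : α // ∃ x : α, y ∈ π x}

/-- The permutational dialect of `L` given by `π`: the image of `L` under the substitution that
replaces a letter `x` by `π x` where `π x` is defined, and by the empty language otherwise,
as a language over the alphabet `π(α)`. Thus a word `u ∈ L` contributes only if `π` is defined on
all letters of `u`, and then it contributes the word obtained by applying `π` letter by letter. -/
def dialect {α : Type*} (π : α ≃. α) (L : Language α) : Language (DialectAlphabet π) :=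
  {w | ∃ u ∈ L, u.map π = w.map (fun y => some y.val)}

/-- The six-letter alphabet `Σ = {a, b, c, d, e, f}`. -/
inductive Letter : Type
  | a | b | c | d | e | f
  deriving DecidableEq

/-- The state set `Q_n = {1, 2, …, n}`. -/
abbrev State (n : ℕ) : Type := {q : ℕ // 1 ≤ q ∧ q ≤ n}

/-- The transformation of `Q_n` induced by each letter:
`a : (2, 3, …, n-1)`, `b : (2, 3)`, `c : (n-1 → 2)`, `d : (n-1 → 1)`, `e : (Q_{n-1} → 2)`,
`f : (2 → n)`. -/
def act (n : ℕ) : Letter → ℕ → ℕ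
  | .a, q => if q = n - 1 then 2 else if 2 ≤ q ∧ q ≤ n - 2 then q + 1 else q
  | .b, q => if q = 2 then 3 else if q = 3 then 2 else q
  | .c, q => if q = n - 1 then 2 else q
  | .d, q => if q = n - 1 then 1 else q
  | .e, q => if q ≤ n - 1 then 2 else q
  | .f, q => if q = 2 then n else q

theorem act_mem {n : ℕ} (hn : 5 ≤ n) (x : Letter) {q : ℕ} (hq : 1 ≤ q ∧ q ≤ n) :
    1 ≤ act n x q ∧ act n x q ≤ n := by
  cases x <;> simp only [act] <;> split_ifs <;> omega

/-- The DFA `D_n(a,b,c,d,e,f)`, `n ≥ 5`, with initial state `1` and set of final states `{n}`. -/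
def automaton (n : ℕ) (hn : 5 ≤ n) : DFA Letter (State n) where
  step q x := ⟨act n x q.val, act_mem hn x q.property⟩
  start := ⟨1, by omega⟩
  accept := {q | q.val = n}

/-- The language `L_n(a,b,c,d,e,f)`. -/
def stream (n : ℕ) (hn : 5 ≤ n) : Language Letter := (automaton n hn).accepts

/-- The partial permutation of `Σ` that fixes `a, b, d, e, f` and is undefined at `c`. -/
def omitC : Letter ≃. Letter := PEquiv.ofSet {x | x ≠ Letter.c}

/-- The dialect `L_n(a,b,-,d,e,f)`, a language over the alphabet `{a, b, d, e, f}`. -/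
def streamOmitC (n : ℕ) (hn : 5 ≤ n) : Language (DialectAlphabet omitC) :=
  dialect omitC (stream n hn)

end IdealStream

/-! The quotients of a Boolean combination are the languages of the reachable states of the direct
product of the two DFAs, so one counts reachable pairs up to equivalence. All mn pairs are
reachable: `e` leads from (1,1) to (2,2), words over {a,b} permute the inner pairs transitively
because the two cycles `a` have different lengths (`Linked.of_inner`), and `f` and `d` lead on to
the extreme states (`exists_run_eq`). For separation, a permutation word followed by `f` makes one
chosen inner state final and no other non-final state (`exists_run_eq_top`), while `e` levels all
non-final states (`exists_run_collapse`). For ∩ and ⊕ all pairs are inequivalent. For the difference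
the m pairs (p,n) all have empty language, and for the union the m+n-1 pairs with a final component
all accept everything; each such class counts once. -/

namespace IdealStream

/-! ### Runs of words and membership in the dialect -/

/-- The state reached from `q` by reading the word `w` in the DFA with `n` states. -/
def run (n : ℕ) (w : List (DialectAlphabet omitC)) (q : ℕ) : ℕ :=
  w.foldl (fun q x => act n x.val q) q

@[simp] theorem run_nil (n q : ℕ) : run n [] q = q := rfl

@[simp] theorem run_cons (n : ℕ) (x : DialectAlphabet omitC) (w : List (DialectAlphabet omitC))
    (q : ℕ) : run n (x :: w) q = run n w (act n x.val q) := rfl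

theorem run_append (n : ℕ) (u w : List (DialectAlphabet omitC)) (q : ℕ) :
    run n (u ++ w) q = run n w (run n u q) := by
  simp [run, List.foldl_append]

theorem run_mem {n : ℕ} (hn : 5 ≤ n) (w : List (DialectAlphabet omitC)) {q : ℕ}
    (hq : 1 ≤ q ∧ q ≤ n) : 1 ≤ run n w q ∧ run n w q ≤ n := by
  induction w generalizing q with
  | nil => exact hq
  | cons x w ih => exact ih (act_mem hn _ hq)

theorem run_top {n : ℕ} (hn : 5 ≤ n) (w : List (DialectAlphabet omitC)) : run n w n = n := by
  induction w with
  | nil => rfl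
  | cons x w ih =>
    have : act n x.val n = n := by
      rcases x.val <;> simp only [act] <;> split_ifs <;> omega
    rw [run_cons, this, ih]

theorem mem_dialectAlphabet {x : Letter} (hx : x ≠ .c) : ∃ y : Letter, x ∈ omitC y :=
  ⟨x, by simpa [omitC, PEquiv.mem_ofSet_iff] using hx⟩

abbrev letterA : DialectAlphabet omitC := ⟨.a, mem_dialectAlphabet (by decide)⟩
abbrev letterB : DialectAlphabet omitC := ⟨.b, mem_dialectAlphabet (by decide)⟩
abbrev letterD : DialectAlphabet omitC := ⟨.d, mem_dialectAlphabet (by decide)⟩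
abbrev letterE : DialectAlphabet omitC := ⟨.e, mem_dialectAlphabet (by decide)⟩
abbrev letterF : DialectAlphabet omitC := ⟨.f, mem_dialectAlphabet (by decide)⟩

theorem map_omitC_eq_iff (u : List Letter) (w : List (DialectAlphabet omitC)) :
    u.map omitC = w.map (fun y => some y.val) ↔ u = w.map Subtype.val := by
  have key : ∀ (x : Letter) (y : DialectAlphabet omitC), omitC x = some y.val ↔ x = y.val := by
    rintro x ⟨y, z, hz⟩
    have hz' : y ∈ omitC z ↔ _ := PEquiv.mem_ofSet_iff
    have hx : y ∈ omitC x ↔ _ := PEquiv.mem_ofSet_iff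
    have hy := hz'.1 hz
    rw [Option.mem_def] at hx
    rw [hx]
    constructor
    · rintro ⟨h, -⟩; exact h.symm
    · rintro rfl; exact ⟨rfl, hy.1 ▸ hy.2⟩
  induction u generalizing w with
  | nil => cases w <;> simp
  | cons x u ih =>
    cases w with
    | nil => simp
    | cons y w =>
      simp only [List.map_cons, List.cons.injEq, ih, key]

theorem evalFrom_val {n : ℕ} (hn : 5 ≤ n) (w : List (DialectAlphabet omitC)) (q : State n) :
    ((automaton n hn).evalFrom q (w.map Subtype.val)).val = run n w q.val := by
  induction w generalizing q with
  | nil => rfl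
  | cons x w ih => exact ih _

theorem mem_streamOmitC_iff {n : ℕ} (hn : 5 ≤ n) (w : List (DialectAlphabet omitC)) :
    w ∈ streamOmitC n hn ↔ run n w 1 = n := by
  have h : w ∈ streamOmitC n hn ↔
      ∃ u ∈ stream n hn, u.map omitC = w.map (fun y => some y.val) := Iff.rfl
  simp only [h, map_omitC_eq_iff, exists_eq_right]
  exact Eq.congr (evalFrom_val hn w (automaton n hn).start) rfl

/-! ### Permutation words and transitivity on inner pairs -/

/-- Words over `{a, b}`; these act as permutations fixing the initial and the final state. -/
def IsPermWord (w : List (DialectAlphabet omitC)) : Prop :=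
  ∀ x ∈ w, x.val = .a ∨ x.val = .b

theorem IsPermWord.append {u w : List (DialectAlphabet omitC)} (hu : IsPermWord u)
    (hw : IsPermWord w) : IsPermWord (u ++ w) := fun x hx =>
  (List.mem_append.1 hx).elim (hu x) (hw x)

theorem act_injective_of_perm {n : ℕ} (hn : 5 ≤ n) {x : Letter} (hx : x = .a ∨ x = .b) :
    Function.Injective (act n x) := by
  intro p q h
  rcases hx with rfl | rfl <;> simp only [act] at h <;> split_ifs at h <;> omega

theorem IsPermWord.run_injective {n : ℕ} (hn : 5 ≤ n) {w : List (DialectAlphabet omitC)}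
    (hw : IsPermWord w) : Function.Injective (run n w) := by
  induction w with
  | nil => exact fun _ _ h => h
  | cons x w ih =>
    exact (ih fun y hy => hw y (List.mem_cons_of_mem _ hy)).comp
      (act_injective_of_perm hn (hw x List.mem_cons_self))

theorem IsPermWord.run_one {n : ℕ} (hn : 5 ≤ n) {w : List (DialectAlphabet omitC)}
    (hw : IsPermWord w) : run n w 1 = 1 := by
  induction w with
  | nil => rfl
  | cons x w ih =>
    have : act n x.val 1 = 1 := by
      rcases hw x List.mem_cons_self with h | h <;> rw [h] <;> simp only [act] <;>
        split_ifs <;> omega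
    rw [run_cons, this, ih fun y hy => hw y (List.mem_cons_of_mem _ hy)]

/-- Some word over `{a, b}` takes `(p, q)` to `(p', q')` in the direct product. -/
def Linked (m n p q p' q' : ℕ) : Prop :=
  ∃ w, IsPermWord w ∧ run m w p = p' ∧ run n w q = q'

namespace Linked

variable {m n p q p' q' p'' q'' : ℕ}

theorem refl (m n p q : ℕ) : Linked m n p q p q := ⟨[], by simp [IsPermWord], rfl, rfl⟩

theorem trans (h : Linked m n p q p' q') (h' : Linked m n p' q' p'' q'') :
    Linked m n p q p'' q'' := by
  obtain ⟨u, hu, rfl, rfl⟩ := h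
  obtain ⟨w, hw, rfl, rfl⟩ := h'
  exact ⟨u ++ w, hu.append hw, run_append .., run_append ..⟩

theorem swap (h : Linked m n p q p' q') : Linked n m q p q' p' := by
  obtain ⟨w, hw, h₁, h₂⟩ := h
  exact ⟨w, hw, h₂, h₁⟩

/-- A permutation word acts injectively as `g`. The forward orbit `T` of the target is finite and
`g` maps it into itself, hence onto itself; so `T` contains the only preimage of the target, namely
(p,q). -/
theorem symm (hm : 5 ≤ m) (hn : 5 ≤ n) (hp : 1 ≤ p ∧ p ≤ m) (hq : 1 ≤ q ∧ q ≤ n)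
    (h : Linked m n p q p' q') : Linked m n p' q' p q := by
  obtain ⟨w, hw, rfl, rfl⟩ := h
  let g : ℕ × ℕ → ℕ × ℕ := fun x => (run m w x.1, run n w x.2)
  let T : Set (ℕ × ℕ) := {x | Linked m n (run m w p) (run n w q) x.1 x.2}
  have hg : Function.Injective g := fun x y hxy =>
    Prod.ext (hw.run_injective hm (congrArg Prod.fst hxy))
      (hw.run_injective hn (congrArg Prod.snd hxy))
  have hT : T.Finite := by
    refine ((Set.finite_Icc 1 m).prod (Set.finite_Icc 1 n)).subset ?_
    rintro ⟨x, y⟩ ⟨u, -, hx, hy⟩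
    dsimp only at hx hy
    subst hx hy
    exact ⟨run_mem hm _ (run_mem hm _ hp), run_mem hn _ (run_mem hn _ hq)⟩
  have hgT : g '' T ⊆ T := by
    rintro _ ⟨x, hx, rfl⟩
    exact Linked.trans hx ⟨w, hw, rfl, rfl⟩
  have heq : g '' T = T :=
    Set.eq_of_subset_of_ncard_le hgT (Set.ncard_image_of_injective T hg).ge hT
  have hmem : g (p, q) ∈ g '' T := heq.symm.subset (Linked.refl m n _ _)
  obtain ⟨y, hy, hyx⟩ := hmem
  rwa [hg hyx] at hy

theorem actA (m n p q : ℕ) : Linked m n p q (act m .a p) (act n .a q) :=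
  ⟨[letterA], by simp [IsPermWord], rfl, rfl⟩

theorem actB (m n p q : ℕ) : Linked m n p q (act m .b p) (act n .b q) :=
  ⟨[letterB], by simp [IsPermWord], rfl, rfl⟩

/-- Repeating `a` climbs the diagonal until the shorter cycle wraps first, giving (2,m). Within row
2, `a` followed by the inverse of `b` raises the second component by one from 3 on, which connects
(2,m) to the rest of the row. Since `a` permutes the inner second components, it carries each full
row onto the next. -/
theorem two_two_of_lt (hm : 5 ≤ m) (hmn : m < n) (hp : 2 ≤ p ∧ p < m) (hq : 2 ≤ q ∧ q < n) :
    Linked m n 2 2 p q := by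
  have hn : 5 ≤ n := by omega
  have diag : ∀ k, k + 2 < m → Linked m n 2 2 (k + 2) (k + 2) := by
    intro k
    induction k with
    | zero => exact fun _ => refl ..
    | succ k ih =>
      intro hk
      have h := (ih (by omega)).trans (actA ..)
      simp only [act] at h
      rwa [if_neg (by omega), if_pos (by omega), if_neg (by omega), if_pos (by omega)] at h
  have wrap : Linked m n 2 2 2 m := by
    have h := (diag (m - 3) (by omega)).trans (actA ..)
    simp only [act] at h
    rw [if_pos (by omega), if_neg (by omega), if_pos (by omega)] at h
    convert h using 1
    omega
  have shift : ∀ k, 3 ≤ k → k + 1 < n → Linked m n 2 k 2 (k + 1) := by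
    intro k hk hkn
    have h₁ := actA m n 2 k
    have h₂ := actB m n 2 (k + 1)
    simp only [act] at h₁ h₂
    rw [if_neg (by omega), if_pos (by omega), if_neg (by omega), if_pos (by omega)] at h₁
    rw [if_pos trivial, if_neg (by omega), if_neg (by omega)] at h₂
    exact h₁.trans (h₂.symm hm hn (by omega) (by omega))
  have up : ∀ k, k + 3 < n → Linked m n 2 3 2 (k + 3) := by
    intro k
    induction k with
    | zero => exact fun _ => refl ..
    | succ k ih => exact fun hk => (ih (by omega)).trans (shift _ (by omega) (by omega))
  have row : ∀ q, 2 ≤ q → q < n → Linked m n 2 2 2 q := by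
    intro q hq hqn
    rcases hq.eq_or_lt with rfl | hq
    · exact refl ..
    · have h₁ := up (m - 3) (by omega)
      have h₂ := up (q - 3) (by omega)
      rw [Nat.sub_add_cancel (by omega)] at h₁ h₂
      exact wrap.trans ((h₁.symm hm hn (by omega) (by omega)).trans h₂)
  have all : ∀ k, k + 2 < m → ∀ q, 2 ≤ q → q < n → Linked m n 2 2 (k + 2) q := by
    intro k
    induction k with
    | zero => exact fun _ => row
    | succ k ih =>
      intro hk q hq hqn
      -- The second component chosen here is the predecessor of `q` on the cycle `a`.
      have h := (ih (by omega) (if q = 2 then n - 1 else q - 1) (by split_ifs <;> omega)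
        (by split_ifs <;> omega)).trans (actA ..)
      convert h using 1
      · simp only [act]; split_ifs <;> omega
      · simp only [act]; split_ifs <;> omega
  have h := all (p - 2) (by omega) q hq.1 hq.2
  rwa [Nat.sub_add_cancel hp.1] at h

/-- Words over `{a, b}` act transitively on the pairs of inner states. -/
theorem of_inner (hm : 5 ≤ m) (hn : 5 ≤ n) (hmn : m ≠ n) (hp : 2 ≤ p ∧ p < m)
    (hq : 2 ≤ q ∧ q < n) (hp' : 2 ≤ p' ∧ p' < m) (hq' : 2 ≤ q' ∧ q' < n) :
    Linked m n p q p' q' := by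
  have base : ∀ {p q : ℕ}, 2 ≤ p ∧ p < m → 2 ≤ q ∧ q < n → Linked m n 2 2 p q := by
    intro p q hp hq
    rcases hmn.lt_or_gt with h | h
    · exact two_two_of_lt hm h hp hq
    · exact (two_two_of_lt hn h hq hp).swap
  exact ((base hp hq).symm hm hn (by omega) (by omega)).trans (base hp' hq')

end Linked

/-! ### Reachability in the direct product -/

/-- Every pair of states is reachable in the direct product. -/
theorem exists_run_eq {m n p q : ℕ} (hm : 5 ≤ m) (hn : 5 ≤ n) (hmn : m ≠ n)
    (hp : 1 ≤ p ∧ p ≤ m) (hq : 1 ≤ q ∧ q ≤ n) : ∃ w, run m w 1 = p ∧ run n w 1 = q := by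
  let R : ℕ → ℕ → Prop := fun p q => ∃ w, run m w 1 = p ∧ run n w 1 = q
  have step : ∀ {p q : ℕ} (x : DialectAlphabet omitC), R p q →
      R (act m x.val p) (act n x.val q) := by
    rintro p q x ⟨w, rfl, rfl⟩
    exact ⟨w ++ [x], by simp [run_append], by simp [run_append]⟩
  have inner : ∀ {p q : ℕ}, 2 ≤ p ∧ p < m → 2 ≤ q ∧ q < n → R p q := by
    intro p q hp hq
    obtain ⟨w, -, h₁, h₂⟩ := Linked.of_inner hm hn hmn (p := 2) (q := 2) (by omega) (by omega) hp hq
    refine ⟨letterE :: w, ?_, ?_⟩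
    · rw [run_cons, show act m .e 1 = 2 from if_pos (by omega), h₁]
    · rw [run_cons, show act n .e 1 = 2 from if_pos (by omega), h₂]
  have move : ∀ {p q p' q' : ℕ} (x : DialectAlphabet omitC), R p q → act m x.val p = p' →
      act n x.val q = q' → R p' q' := by
    rintro p q _ _ x h rfl rfl
    exact step x h
  have topInner : ∀ {q : ℕ}, 2 ≤ q ∧ q < n → R m q := by
    intro q hq
    -- `f` would also move a second component 2, so (m,2) is reached from (m,n-1) by `a` instead.
    have h3 : ∀ {q : ℕ}, 3 ≤ q ∧ q < n → R m q := fun hq =>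
      move letterF (inner (p := 2) (by omega) ⟨by omega, hq.2⟩)
        (by simp only [act]; split_ifs <;> omega) (by simp only [act]; split_ifs <;> omega)
    by_cases h : q = 2
    · exact move letterA (h3 (q := n - 1) (by omega)) (by simp only [act]; split_ifs <;> omega)
        (by simp only [act]; split_ifs <;> omega)
    · exact h3 (by omega)
  have innerTop : ∀ {p : ℕ}, 2 ≤ p ∧ p < m → R p n := by
    intro p hp
    have h3 : ∀ {p : ℕ}, 3 ≤ p ∧ p < m → R p n := fun hp =>
      move letterF (inner (q := 2) ⟨by omega, hp.2⟩ (by omega))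
        (by simp only [act]; split_ifs <;> omega) (by simp only [act]; split_ifs <;> omega)
    by_cases h : p = 2
    · exact move letterA (h3 (p := m - 1) (by omega)) (by simp only [act]; split_ifs <;> omega)
        (by simp only [act]; split_ifs <;> omega)
    · exact h3 (by omega)
  have oneInner : ∀ {q : ℕ}, 2 ≤ q ∧ q < n → R 1 q := by
    intro q hq
    -- `d` would also move n-1, so (1,n-1) is reached from (1,n-2) by `a` instead.
    have h3 : ∀ {q : ℕ}, 2 ≤ q ∧ q < n - 1 → R 1 q := fun hq =>
      move letterD (inner (p := m - 1) (by omega) ⟨hq.1, by omega⟩)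
        (by simp only [act]; split_ifs <;> omega) (by simp only [act]; split_ifs <;> omega)
    by_cases h : q = n - 1
    · exact move letterA (h3 (q := n - 2) (by omega)) (by simp only [act]; split_ifs <;> omega)
        (by simp only [act]; split_ifs <;> omega)
    · exact h3 (by omega)
  have innerOne : ∀ {p : ℕ}, 2 ≤ p ∧ p < m → R p 1 := by
    intro p hp
    have h3 : ∀ {p : ℕ}, 2 ≤ p ∧ p < m - 1 → R p 1 := fun hp =>
      move letterD (inner (q := n - 1) ⟨hp.1, by omega⟩ (by omega))
        (by simp only [act]; split_ifs <;> omega) (by simp only [act]; split_ifs <;> omega)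
    by_cases h : p = m - 1
    · exact move letterA (h3 (p := m - 2) (by omega)) (by simp only [act]; split_ifs <;> omega)
        (by simp only [act]; split_ifs <;> omega)
    · exact h3 (by omega)
  have one_or : ∀ {k r : ℕ}, 1 ≤ r ∧ r ≤ k → r = 1 ∨ (2 ≤ r ∧ r < k) ∨ r = k := by omega
  rcases one_or hp with rfl | hp | rfl <;> rcases one_or hq with rfl | hq | rfl
  · exact ⟨[], rfl, rfl⟩
  · exact oneInner hq
  · exact move letterD (innerTop (p := m - 1) (by omega)) (by simp only [act]; split_ifs <;> omega)
      (by simp only [act]; split_ifs <;> omega)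
  · exact innerOne hp
  · exact inner hp hq
  · exact innerTop hp
  · exact move letterD (topInner (q := n - 1) (by omega)) (by simp only [act]; split_ifs <;> omega)
      (by simp only [act]; split_ifs <;> omega)
  · exact topInner hq
  · exact move letterF (inner (p := 2) (q := 2) (by omega) (by omega)) (by simp [act]) (by simp [act])

/-! ### Quotients as languages of product states -/

/-- The language accepted from the state `x` of the direct product, where `op` combines
acceptance by the two components. -/
def productLanguage (op : Prop → Prop → Prop) (m n : ℕ) (x : ℕ × ℕ) :
    Language (DialectAlphabet omitC) :=
  {w | op (run m w x.1 = m) (run n w x.2 = n)}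

theorem mem_productLanguage {op : Prop → Prop → Prop} {m n : ℕ} {x : ℕ × ℕ}
    {w : List (DialectAlphabet omitC)} :
    w ∈ productLanguage op m n x ↔ op (run m w x.1 = m) (run n w x.2 = n) := Iff.rfl

theorem range_leftQuotient_productLanguage (op : Prop → Prop → Prop) {m n : ℕ} (hm : 5 ≤ m)
    (hn : 5 ≤ n) (hmn : m ≠ n) :
    Set.range (productLanguage op m n (1, 1)).leftQuotient =
      productLanguage op m n '' (Set.Icc 1 m ×ˢ Set.Icc 1 n) := by
  have key : ∀ w, (productLanguage op m n (1, 1)).leftQuotient w =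
      productLanguage op m n (run m w 1, run n w 1) := by
    intro w
    ext u
    rw [Language.mem_leftQuotient, mem_productLanguage, mem_productLanguage, run_append,
      run_append]
  ext K
  constructor
  · rintro ⟨w, rfl⟩
    exact ⟨(run m w 1, run n w 1), ⟨run_mem hm w ⟨le_rfl, by omega⟩,
      run_mem hn w ⟨le_rfl, by omega⟩⟩, (key w).symm⟩
  · rintro ⟨⟨p, q⟩, ⟨hp, hq⟩, rfl⟩
    obtain ⟨w, rfl, rfl⟩ := exists_run_eq hm hn hmn hp hq
    exact ⟨w, key w⟩

/-- Counting quotients by a set of representatives of the states of the direct product. -/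
theorem complexity_productLanguage (op : Prop → Prop → Prop) {m n : ℕ} (hm : 5 ≤ m)
    (hn : 5 ≤ n) (hmn : m ≠ n) (S : Finset (ℕ × ℕ)) (hS : S ⊆ Finset.Icc 1 m ×ˢ Finset.Icc 1 n)
    (hrep : ∀ x ∈ Finset.Icc 1 m ×ˢ Finset.Icc 1 n, ∃ y ∈ S,
      productLanguage op m n y = productLanguage op m n x)
    (hinj : Set.InjOn (productLanguage op m n) S) :
    complexity (productLanguage op m n (1, 1)) = (S.card : ℕ∞) := by
  have h : productLanguage op m n '' (Set.Icc 1 m ×ˢ Set.Icc 1 n) =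
      productLanguage op m n '' (S : Set (ℕ × ℕ)) := by
    have hbox : (Set.Icc 1 m ×ˢ Set.Icc 1 n : Set (ℕ × ℕ)) =
      ((Finset.Icc 1 m ×ˢ Finset.Icc 1 n : Finset (ℕ × ℕ)) : Set (ℕ × ℕ)) := by simp
    rw [hbox]
    refine Set.Subset.antisymm ?_ (Set.image_mono (by exact_mod_cast hS))
    rintro _ ⟨x, hx, rfl⟩
    obtain ⟨y, hy, hyx⟩ := hrep x hx
    exact ⟨y, hy, hyx⟩
  rw [complexity, range_leftQuotient_productLanguage op hm hn hmn, h, hinj.encard_image,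
    Set.encard_coe_eq_coe_finsetCard]

/-! ### Separating inequivalent pairs -/

/-- A word that makes the first component accept from `p` and from no other non-final state, while
the second component does not accept from `q`. -/
theorem exists_run_eq_top {m n p q : ℕ} (hm : 5 ≤ m) (hn : 5 ≤ n) (hmn : m ≠ n)
    (hp : 2 ≤ p ∧ p < m) (hq : 1 ≤ q ∧ q < n) :
    ∃ w, run m w p = m ∧ run n w q ≠ n ∧ ∀ p', p' ≠ p → p' ≠ m → run m w p' ≠ m := by
  -- Besides the final state, `f` makes only 2 final; so `p` goes to 2, and `q` stays at 1 or goes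
  -- to 3.
  obtain ⟨w, hw, hwp, hwq⟩ : ∃ w, IsPermWord w ∧ run m w p = 2 ∧ run n w q ≠ 2 ∧
      run n w q ≠ n := by
    rcases hq.1.eq_or_lt with rfl | h
    · obtain ⟨w, hw, h₁, -⟩ := Linked.of_inner hm hn hmn hp (q := 2) (by omega) (p' := 2)
        (q' := 2) (by omega) (by omega)
      exact ⟨w, hw, h₁, by rw [hw.run_one hn]; omega⟩
    · obtain ⟨w, hw, h₁, h₂⟩ := Linked.of_inner hm hn hmn hp (q := q) ⟨h, hq.2⟩ (p' := 2)
        (q' := 3) (by omega) (by omega)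
      exact ⟨w, hw, h₁, by omega⟩
  refine ⟨w ++ [letterF], ?_, ?_, fun p' hp' hm' => ?_⟩
  · simp [run_append, hwp, act]
  · simp [run_append, hwq, act]
  · have h2 : run m w p' ≠ 2 := fun h => hp' (hw.run_injective hm (h.trans hwp.symm))
    have hm2 : run m w p' ≠ m := fun h =>
      hm' (hw.run_injective hm (h.trans (run_top hm w).symm))
    simp [run_append, h2, hm2, act]

/-- Two pairs with distinct first components can be collapsed to pairs with first components
`m` and `2`, in some order, and second components in `{2, n}`. -/
theorem exists_run_collapse {m n p p' q q' : ℕ} (hm : 5 ≤ m) (hn : 5 ≤ n) (hmn : m ≠ n)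
    (hp : 1 ≤ p ∧ p ≤ m) (hp' : 1 ≤ p' ∧ p' ≤ m) (hq : 1 ≤ q ∧ q ≤ n) (hq' : 1 ≤ q' ∧ q' ≤ n)
    (hne : p ≠ p') :
    ∃ w, ((run m w p = m ∧ run m w p' = 2) ∨ (run m w p = 2 ∧ run m w p' = m)) ∧
      (run n w q = 2 ∨ run n w q = n) ∧ (run n w q' = 2 ∨ run n w q' = n) := by
  obtain ⟨w, hw⟩ : ∃ w, (run m w p = m ∧ run m w p' ≠ m) ∨ (run m w p ≠ m ∧ run m w p' = m) := by
    by_cases h₁ : p = m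
    · exact ⟨[], Or.inl ⟨h₁, by simp only [run_nil]; omega⟩⟩
    by_cases h₂ : p' = m
    · exact ⟨[], Or.inr ⟨h₁, h₂⟩⟩
    by_cases h₃ : p = 1
    · obtain ⟨w, h, -, h'⟩ := exists_run_eq_top hm hn hmn (p := p') (q := 1) (by omega) (by omega)
      exact ⟨w, Or.inr ⟨h' p hne h₁, h⟩⟩
    · obtain ⟨w, h, -, h'⟩ := exists_run_eq_top hm hn hmn (p := p) (q := 1) (by omega) (by omega)
      exact ⟨w, Or.inl ⟨h, h' p' hne.symm h₂⟩⟩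
  have b₁ := run_mem hm w hp
  have b₂ := run_mem hm w hp'
  have b₃ := run_mem hn w hq
  have b₄ := run_mem hn w hq'
  refine ⟨w ++ [letterE], ?_⟩
  simp only [run_append, run_cons, run_nil, act]
  split_ifs <;> omega

/-- After the collapse, `u` sends 2 to n in the second component but not 2 to m in the first, so
exactly one pair ends in (m,n). -/
theorem fst_eq_of_and {m n p p' q q' : ℕ} (hm : 5 ≤ m) (hn : 5 ≤ n) (hmn : m ≠ n)
    (hp : 1 ≤ p ∧ p ≤ m) (hp' : 1 ≤ p' ∧ p' ≤ m) (hq : 1 ≤ q ∧ q ≤ n) (hq' : 1 ≤ q' ∧ q' ≤ n)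
    (h : ∀ w, (run m w p = m ∧ run n w q = n) ↔ (run m w p' = m ∧ run n w q' = n)) :
    p = p' := by
  by_contra hne
  obtain ⟨w, hw, hwq, hwq'⟩ := exists_run_collapse hm hn hmn hp hp' hq hq' hne
  obtain ⟨u, hu, hu', -⟩ := exists_run_eq_top hn hm hmn.symm (p := 2) (q := 2) (by omega) (by omega)
  have h' := h (w ++ u)
  simp only [run_append] at h'
  rcases hw with ⟨e₁, e₂⟩ | ⟨e₁, e₂⟩ <;> rcases hwq with e₃ | e₃ <;> rcases hwq' with e₄ | e₄ <;>
    simp [e₁, e₂, e₃, e₄, hu, hu', run_top hm u, run_top hn u] at h'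

/-- After the collapse, equal second components are separated by the empty word. Otherwise `u` makes
both first components final, but only one of the second. -/
theorem fst_eq_of_xor {m n p p' q q' : ℕ} (hm : 5 ≤ m) (hn : 5 ≤ n) (hmn : m ≠ n)
    (hp : 1 ≤ p ∧ p ≤ m) (hp' : 1 ≤ p' ∧ p' ≤ m) (hq : 1 ≤ q ∧ q ≤ n) (hq' : 1 ≤ q' ∧ q' ≤ n)
    (h : ∀ w, (run m w p = m ∧ run n w q ≠ n ∨ run n w q = n ∧ run m w p ≠ m) ↔
      (run m w p' = m ∧ run n w q' ≠ n ∨ run n w q' = n ∧ run m w p' ≠ m)) :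
    p = p' := by
  by_contra hne
  obtain ⟨w, hw, hwq, hwq'⟩ := exists_run_collapse hm hn hmn hp hp' hq hq' hne
  obtain ⟨u, hu, hu', -⟩ := exists_run_eq_top hm hn hmn (p := 2) (q := 2) (by omega) (by omega)
  have h₀ := h w
  have h₁ := h (w ++ u)
  simp only [run_append] at h₁
  have hm2 : 2 ≠ m := by omega
  have hn2 : 2 ≠ n := by omega
  rcases hw with ⟨e₁, e₂⟩ | ⟨e₁, e₂⟩ <;> rcases hwq with e₃ | e₃ <;> rcases hwq' with e₄ | e₄ <;>
    simp [e₁, e₂, e₃, e₄, hu, hu', hm2, hn2, run_top hm, run_top hn] at h₀ h₁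

/-- One of two distinct first components is not 1; it can be made final while the other pair keeps
both components non-final. -/
theorem fst_eq_of_or {m n p p' q q' : ℕ} (hm : 5 ≤ m) (hn : 5 ≤ n) (hmn : m ≠ n)
    (hp : 1 ≤ p ∧ p < m) (hp' : 1 ≤ p' ∧ p' < m) (hq : 1 ≤ q ∧ q < n) (hq' : 1 ≤ q' ∧ q' < n)
    (h : ∀ w, (run m w p = m ∨ run n w q = n) ↔ (run m w p' = m ∨ run n w q' = n)) :
    p = p' := by
  by_contra hne
  by_cases h1 : p = 1
  · obtain ⟨w, h₁, h₂, h₃⟩ := exists_run_eq_top hm hn hmn (p := p') (q := q) (by omega) hq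
    simpa [h₁, h₂, h₃ p hne hp.2.ne] using h w
  · obtain ⟨w, h₁, h₂, h₃⟩ := exists_run_eq_top hm hn hmn (p := p) (q := q') (by omega) hq'
    simpa [h₁, h₂, h₃ p' (Ne.symm hne) hp'.2.ne] using h w

theorem fst_eq_of_and_not {m n p p' q q' : ℕ} (hm : 5 ≤ m) (hn : 5 ≤ n) (hmn : m ≠ n)
    (hp : 1 ≤ p ∧ p ≤ m) (hp' : 1 ≤ p' ∧ p' ≤ m) (hq : 1 ≤ q ∧ q < n) (hq' : 1 ≤ q' ∧ q' < n)
    (h : ∀ w, (run m w p = m ∧ run n w q ≠ n) ↔ (run m w p' = m ∧ run n w q' ≠ n)) :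
    p = p' := by
  by_contra hne
  have h₀ := h []
  simp only [run_nil] at h₀
  have hpm : p ≠ m := by omega
  have hpm' : p' ≠ m := by omega
  by_cases h1 : p = 1
  · obtain ⟨w, h₁, h₂, h₃⟩ := exists_run_eq_top hm hn hmn (p := p') (q := q') (by omega) hq'
    simpa [h₁, h₂, h₃ p hne hpm] using h w
  · obtain ⟨w, h₁, h₂, h₃⟩ := exists_run_eq_top hm hn hmn (p := p) (q := q) (by omega) hq
    simpa [h₁, h₂, h₃ p' (Ne.symm hne) hpm'] using h w

theorem exists_run_and_not {m n p q : ℕ} (hm : 5 ≤ m) (hn : 5 ≤ n) (hmn : m ≠ n)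
    (hp : 1 ≤ p ∧ p ≤ m) (hq : 1 ≤ q ∧ q < n) : ∃ w, run m w p = m ∧ run n w q ≠ n := by
  obtain ⟨u, hu, hu', -⟩ := exists_run_eq_top hm hn hmn (p := 2) (q := 2) (by omega) (by omega)
  have hq2 : act n .e q = 2 := if_pos (by omega)
  refine ⟨letterE :: u, ?_, by simpa [hq2] using hu'⟩
  by_cases h : p = m
  · rw [h, run_top hm]
  · have hp2 : act m .e p = 2 := if_pos (by omega)
    simpa [hp2] using hu

theorem snd_eq_of_and_not {m n p p' q q' : ℕ} (hm : 5 ≤ m) (hn : 5 ≤ n) (hmn : m ≠ n)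
    (hp : 1 ≤ p ∧ p ≤ m) (hp' : 1 ≤ p' ∧ p' ≤ m) (hq : 1 ≤ q ∧ q ≤ n) (hq' : 1 ≤ q' ∧ q' ≤ n)
    (h : ∀ w, (run m w p = m ∧ run n w q ≠ n) ↔ (run m w p' = m ∧ run n w q' ≠ n)) :
    q = q' := by
  have key : ∀ {p p' q q' : ℕ}, 1 ≤ p' ∧ p' ≤ m → 2 ≤ q ∧ q ≤ n → 1 ≤ q' ∧ q' ≤ n →
      q' < n → (∀ w, (run m w p = m ∧ run n w q ≠ n) ↔ (run m w p' = m ∧ run n w q' ≠ n)) →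
      q = q' := by
    intro p p' q q' hp' hq hq' hlt h
    by_contra hne
    -- Once the second component is n, nothing more is accepted, whereas the other pair can still
    -- reach acceptance.
    obtain ⟨w, h₁, h₂⟩ : ∃ w, run n w q = n ∧ run n w q' ≠ n := by
      by_cases hqn : q = n
      · exact ⟨[], hqn, hlt.ne⟩
      · obtain ⟨w, h₁, -, h₂⟩ := exists_run_eq_top hn hm hmn.symm (p := q) (q := 1) (by omega)
          (by omega)
        exact ⟨w, h₁, h₂ q' (Ne.symm hne) hlt.ne⟩
    have b := run_mem hn w hq'
    obtain ⟨u, hu, hu'⟩ := exists_run_and_not hm hn hmn (run_mem hm w hp')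
      (q := run n w q') (by omega)
    have h' := h (w ++ u)
    simp [run_append, h₁, hu, hu', run_top hn] at h'
  by_contra hne
  by_cases hc : 2 ≤ q ∧ q' < n
  · exact hne (key hp' ⟨hc.1, hq.2⟩ hq' hc.2 h)
  · exact hne (key hp (by omega) hq (by omega) fun w => (h w).symm).symm

/-! ### Counting the classes -/

theorem complexity_inf {m n : ℕ} (hm : 5 ≤ m) (hn : 5 ≤ n) (hmn : m ≠ n) :
    complexity (streamOmitC m hm ⊓ streamOmitC n hn) = ((m * n : ℕ) : ℕ∞) := by
  have hL : streamOmitC m hm ⊓ streamOmitC n hn = productLanguage And m n (1, 1) := by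
    ext w
    exact and_congr (mem_streamOmitC_iff hm w) (mem_streamOmitC_iff hn w)
  rw [hL, complexity_productLanguage And hm hn hmn _ subset_rfl (fun x hx => ⟨x, hx, rfl⟩)]
  · simp
  · rintro ⟨p, q⟩ hx ⟨p', q'⟩ hy hxy
    simp only [Finset.mem_coe, Finset.mem_product, Finset.mem_Icc] at hx hy
    have h : ∀ w, _ ↔ _ := fun w => Set.ext_iff.1 hxy w
    exact Prod.ext (fst_eq_of_and hm hn hmn hx.1 hy.1 hx.2 hy.2 h)
      (fst_eq_of_and hn hm hmn.symm hx.2 hy.2 hx.1 hy.1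
        fun w => and_comm.trans ((h w).trans and_comm))

theorem complexity_symmDiff {m n : ℕ} (hm : 5 ≤ m) (hn : 5 ≤ n) (hmn : m ≠ n) :
    complexity (symmDiff (streamOmitC m hm) (streamOmitC n hn)) = ((m * n : ℕ) : ℕ∞) := by
  have hL : symmDiff (streamOmitC m hm) (streamOmitC n hn) =
      productLanguage (fun P Q => P ∧ ¬Q ∨ Q ∧ ¬P) m n (1, 1) := by
    ext w
    have h₁ := mem_streamOmitC_iff hm w
    have h₂ := mem_streamOmitC_iff hn w
    exact or_congr (and_congr h₁ (not_congr h₂)) (and_congr h₂ (not_congr h₁))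
  rw [hL, complexity_productLanguage _ hm hn hmn _ subset_rfl (fun x hx => ⟨x, hx, rfl⟩)]
  · simp
  · rintro ⟨p, q⟩ hx ⟨p', q'⟩ hy hxy
    simp only [Finset.mem_coe, Finset.mem_product, Finset.mem_Icc] at hx hy
    have h : ∀ w, _ ↔ _ := fun w => Set.ext_iff.1 hxy w
    exact Prod.ext (fst_eq_of_xor hm hn hmn hx.1 hy.1 hx.2 hy.2 h)
      (fst_eq_of_xor hn hm hmn.symm hx.2 hy.2 hx.1 hy.1
        fun w => or_comm.trans ((h w).trans or_comm))

theorem complexity_sdiff {m n : ℕ} (hm : 5 ≤ m) (hn : 5 ≤ n) (hmn : m ≠ n) :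
    complexity (streamOmitC m hm \ streamOmitC n hn) = ((m * n - (m - 1) : ℕ) : ℕ∞) := by
  have hL : streamOmitC m hm \ streamOmitC n hn =
      productLanguage (fun P Q => P ∧ ¬Q) m n (1, 1) := by
    ext w
    exact and_congr (mem_streamOmitC_iff hm w) (not_congr (mem_streamOmitC_iff hn w))
  -- (1,n) represents all pairs with empty language.
  let S : Finset (ℕ × ℕ) := insert (1, n) (Finset.Icc 1 m ×ˢ Finset.Icc 1 (n - 1))
  have hS : ∀ p q, (p, q) ∈ S ↔ (p = 1 ∧ q = n) ∨ (1 ≤ p ∧ p ≤ m) ∧ 1 ≤ q ∧ q ≤ n - 1 := by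
    simp [S]
  rw [hL, complexity_productLanguage _ hm hn hmn S]
  · congr 1
    rw [Finset.card_insert_of_notMem (by simp; omega), Finset.card_product, Nat.card_Icc,
      Nat.card_Icc]
    obtain ⟨k, rfl⟩ : ∃ k, n = k + 1 := ⟨n - 1, by omega⟩
    simp only [Nat.add_sub_cancel, mul_add]
    omega
  · rintro ⟨p, q⟩ hx
    rw [hS] at hx
    rw [Finset.mem_product, Finset.mem_Icc, Finset.mem_Icc]
    dsimp only
    omega
  · rintro ⟨p, q⟩ hx
    rw [Finset.mem_product, Finset.mem_Icc, Finset.mem_Icc] at hx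
    dsimp only at hx
    by_cases hq : q = n
    · subst hq
      refine ⟨(1, q), (hS _ _).2 (by omega), ?_⟩
      ext w
      simp [mem_productLanguage, run_top hn]
    · exact ⟨(p, q), (hS _ _).2 (by omega), rfl⟩
  · rintro ⟨p, q⟩ hx ⟨p', q'⟩ hy hxy
    rw [Finset.mem_coe, hS] at hx hy
    have h : ∀ w, _ ↔ _ := fun w => Set.ext_iff.1 hxy w
    have hqq : q = q' := snd_eq_of_and_not hm hn hmn (p := p) (p' := p') (by omega) (by omega)
      (by omega) (by omega) h
    subst hqq
    refine Prod.ext ?_ rfl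
    by_cases hq : q = n
    · dsimp only; omega
    · exact fst_eq_of_and_not hm hn hmn (q := q) (q' := q) (by omega) (by omega) (by omega)
        (by omega) h

theorem complexity_sup {m n : ℕ} (hm : 5 ≤ m) (hn : 5 ≤ n) (hmn : m ≠ n) :
    complexity (streamOmitC m hm ⊔ streamOmitC n hn) = ((m * n - (m + n - 2) : ℕ) : ℕ∞) := by
  have hL : streamOmitC m hm ⊔ streamOmitC n hn = productLanguage Or m n (1, 1) := by
    ext w
    exact or_congr (mem_streamOmitC_iff hm w) (mem_streamOmitC_iff hn w)
  -- (m,n) represents all pairs from which every word is accepted.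
  let S : Finset (ℕ × ℕ) := insert (m, n) (Finset.Icc 1 (m - 1) ×ˢ Finset.Icc 1 (n - 1))
  have hS : ∀ p q, (p, q) ∈ S ↔
      (p = m ∧ q = n) ∨ (1 ≤ p ∧ p ≤ m - 1) ∧ 1 ≤ q ∧ q ≤ n - 1 := by
    simp [S]
  rw [hL, complexity_productLanguage _ hm hn hmn S]
  · congr 1
    rw [Finset.card_insert_of_notMem (by simp; omega), Finset.card_product, Nat.card_Icc,
      Nat.card_Icc]
    obtain ⟨j, rfl⟩ : ∃ j, m = j + 1 := ⟨m - 1, by omega⟩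
    obtain ⟨k, rfl⟩ : ∃ k, n = k + 1 := ⟨n - 1, by omega⟩
    simp only [Nat.add_sub_cancel, mul_add, add_mul]
    omega
  · rintro ⟨p, q⟩ hx
    rw [hS] at hx
    rw [Finset.mem_product, Finset.mem_Icc, Finset.mem_Icc]
    dsimp only
    omega
  · rintro ⟨p, q⟩ hx
    rw [Finset.mem_product, Finset.mem_Icc, Finset.mem_Icc] at hx
    dsimp only at hx
    by_cases hf : p = m ∨ q = n
    · refine ⟨(m, n), (hS _ _).2 (by omega), ?_⟩
      ext w
      rcases hf with rfl | rfl <;> simp [mem_productLanguage, run_top hm, run_top hn]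
    · exact ⟨(p, q), (hS _ _).2 (by omega), rfl⟩
  · rintro ⟨p, q⟩ hx ⟨p', q'⟩ hy hxy
    rw [Finset.mem_coe, hS] at hx hy
    have h : ∀ w, _ ↔ _ := fun w => Set.ext_iff.1 hxy w
    have h₀ : (p = m ∨ q = n) ↔ (p' = m ∨ q' = n) := h []
    by_cases hf : p = m ∨ q = n
    · refine Prod.ext ?_ ?_ <;> dsimp only <;> omega
    · exact Prod.ext
        (fst_eq_of_or hm hn hmn (by omega) (by omega) (by omega) (by omega) h)
        (fst_eq_of_or hn hm hmn.symm (by omega) (by omega) (by omega) (by omega)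
          fun w => or_comm.trans ((h w).trans or_comm))

end IdealStream

theorem mainTheorem5 (m n : ℕ) (hm : 5 ≤ m) (hn : 5 ≤ n) (hmn : m ≠ n) :
    IdealStream.complexity
        (IdealStream.streamOmitC m hm ⊓ IdealStream.streamOmitC n hn) = ((m * n : ℕ) : ℕ∞) ∧
    IdealStream.complexity
        (symmDiff (IdealStream.streamOmitC m hm) (IdealStream.streamOmitC n hn)) =
      ((m * n : ℕ) : ℕ∞) ∧
    IdealStream.complexity
        (IdealStream.streamOmitC m hm \ IdealStream.streamOmitC n hn) =
      ((m * n - (m - 1) : ℕ) : ℕ∞) ∧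
    IdealStream.complexity
        (IdealStream.streamOmitC m hm ⊔ IdealStream.streamOmitC n hn) =
      ((m * n - (m + n - 2) : ℕ) : ℕ∞) :=
  ⟨IdealStream.complexity_inf hm hn hmn, IdealStream.complexity_symmDiff hm hn hmn,
    IdealStream.complexity_sdiff hm hn hmn, IdealStream.complexity_sup hm hn hmn⟩
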